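/- Let $W(y|x)$, $x\in\mathcal X$, $y\in\mathcal Y$, be a discrete memoryless channel with finite nonempty input alphabet $\mathcal X$ and finite output alphabet $\mathcal Y$ (so $W(y|x)\ge 0$ and $\sum_y W(y|x)=1$ for every $x$), and let $W^n(\mathbf y|\mathbf x)=\prod_{i=1}^n W(y_i|x_i)$. A blocklength-$n$ rate-$R$ encoder ($R\ge 0$) is a map $f\colon\{1,\dots,M\}\to\mathcal X^n$ with $M=\lfloor e^{nR}\rfloor$; for $\mathbf y\in\mathcal Y^n$ let $\mathcal L(\mathbf y)=\{m: W^n(\mathbf y|f(m))>0\}$. For $\rho>0$ let the listsize capacity $C_{\mathrm{list}}(\rho)$ be the supremum of all rates $R$ for which there is a sequence of blocklength-$n$ rate-$R$ encoders $(f_n)_{n\ge1}$ with $$\lim_{n\to\infty}\frac1{\lfloor e^{nR}\rfloor}\sum_{m}\sum_{\mathbf y\in\mathcal Y^n}W^n(\mathbf y|f_n(m))\,|\mathcal L(\mathbf y)|^\rho=1,$$ and let the zero-undetected-error capacity $C_{\mathrm{zue}}$ be the supremum of all rates $R$ for which there is a sequence of blocklength-$n$ rate-$R$ encoders $(f_n)_{n\ge1}$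 with $$\lim_{n\to\infty}\frac1{\lfloor e^{nR}\rfloor}\sum_{m}\ \sum_{\mathbf y:\,|\mathcal L(\mathbf y)|\ge2}W^n(\mathbf y|f_n(m))=0.$$ Let $\mathcal X(y)=\{x: W(y|x)>0\}$ and $\pi_0=\min_P\max_{y\in\mathcal Y}P(\mathcal X(y))$, where the minimum is over all probability mass functions $P$ on $\mathcal X$. All logarithms are natural. Then: 1. for every $\rho>0$, $C_{\mathrm{list}}(\rho)\le C_{\mathrm{zue}}$; 2. for every $\rho>0$, $C_{\mathrm{list}}(\rho)>0$ if and only if $C_{\mathrm{zue}}>0$, and this holds if and only if there exist $x,x'\in\mathcal X$ and $y\in\mathcal Y$ with $W(y|x)>W(y|x')=0$; 3. $\lim_{\rho\to0^+}C_{\mathrm{list}}(\rho)=C_{\mathrm{zue}}$; 4. $\lim_{\rho\to\infty}C_{\mathrm{list}}(\rho)=-\log\pi_0$. -/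

import Mathlib

open Filter Topology

/-- A discrete memoryless channel with finite input alphabet `X` and finite output alphabet `Y`,
given by its channel matrix; `prob x y` is `W(y|x)`. -/
structure DMC (X Y : Type*) [Fintype X] [Fintype Y] where
  prob : X → Y → ℝ
  prob_nonneg : ∀ x y, 0 ≤ prob x y
  sum_prob : ∀ x, ∑ y, prob x y = 1

/-- A blocklength-`n` rate-`R` encoder: a map from a set of `⌊e^{nR}⌋` messages to `X^n`. -/
abbrev Encoder (X : Type*) (n : ℕ) (R : ℝ) : Type _ :=
  Fin ⌊Real.exp (n * R)⌋₊ → Fin n → X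

namespace DMC

variable {X Y : Type*} [Fintype X] [Fintype Y]

/-- The `n`-letter transition law `W^n(y|x) = ∏ i, W(y_i|x_i)`. -/
def blockProb (W : DMC X Y) {n : ℕ} (x : Fin n → X) (y : Fin n → Y) : ℝ :=
  ∏ i, W.prob (x i) (y i)

/-- The list `L(y)` of all messages that can produce the output sequence `y`. -/
noncomputable def messageList (W : DMC X Y) {n : ℕ} {R : ℝ} (f : Encoder X n R) (y : Fin n → Y) :
    Finset (Fin ⌊Real.exp (n * R)⌋₊) :=
  Finset.univ.filter fun m => 0 < W.blockProb (f m) y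

/-- The `ρ`-th moment of the length of the list `L(Y)`, for equiprobable messages. -/
noncomputable def listMoment (W : DMC X Y) (ρ : ℝ) {n : ℕ} {R : ℝ} (f : Encoder X n R) : ℝ :=
  (⌊Real.exp (n * R)⌋₊ : ℝ)⁻¹ *
    ∑ m, ∑ y : Fin n → Y, W.blockProb (f m) y * ((W.messageList f y).card : ℝ) ^ ρ

/-- The probability that the list `L(Y)` has at least two elements (the probability of an
erasure), for equiprobable messages. -/
noncomputable def erasureProb (W : DMC X Y) {n : ℕ} {R : ℝ} (f : Encoder X n R) : ℝ :=
  (⌊Real.exp (n * R)⌋₊ : ℝ)⁻¹ *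
    ∑ m, ∑ y : Fin n → Y with 2 ≤ (W.messageList f y).card, W.blockProb (f m) y

/-- The rates `R` for which some sequence of blocklength-`n` rate-`R` encoders has a `ρ`-th moment
of the list length tending to one. -/
def listRates (W : DMC X Y) (ρ : ℝ) : Set ℝ :=
  {R | 0 ≤ R ∧ ∃ f : (n : ℕ) → Encoder X (n + 1) R,
    Tendsto (fun n => W.listMoment ρ (f n)) atTop (𝓝 1)}

/-- The rates `R` for which some sequence of blocklength-`n` rate-`R` encoders has an erasure
probability tending to zero. -/
def zueRates (W : DMC X Y) : Set ℝ :=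
  {R | 0 ≤ R ∧ ∃ f : (n : ℕ) → Encoder X (n + 1) R,
    Tendsto (fun n => W.erasureProb (f n)) atTop (𝓝 0)}

/-- The listsize capacity. The supremum is taken in the extended reals, so that it is the true
supremum of the set of rates without any side condition. -/
noncomputable def listCapacity (W : DMC X Y) (ρ : ℝ) : EReal :=
  ⨆ R ∈ W.listRates ρ, (R : EReal)

/-- The zero-undetected-error capacity, again as a supremum in the extended reals. -/
noncomputable def zueCapacity (W : DMC X Y) : EReal :=
  ⨆ R ∈ W.zueRates, (R : EReal)

/-- `X(y)`, the set of inputs that can produce the output letter `y`. -/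
noncomputable def inputsOf (W : DMC X Y) (y : Y) : Finset X :=
  Finset.univ.filter fun x => 0 < W.prob x y

/-- `max_y P(X(y))`, for `P : X → ℝ`. -/
noncomputable def maxMass (W : DMC X Y) (P : X → ℝ) : ℝ :=
  ⨆ y, ∑ x ∈ W.inputsOf y, P x

/-- `π₀ = min_P max_y P(X(y))`, where `P` ranges over the probability mass functions on `X`. -/
noncomputable def piZero (W : DMC X Y) : ℝ :=
  sInf (W.maxMass '' stdSimplex ℝ X)

theorem nonempty_output [Nonempty X] (W : DMC X Y) : Nonempty Y := by
  by_contra h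
  rw [not_nonempty_iff] at h
  simpa using W.sum_prob (Classical.arbitrary X)

/-- The supremum in `maxMass` is a maximum. -/
theorem isGreatest_maxMass [Nonempty X] (W : DMC X Y) (P : X → ℝ) :
    IsGreatest (Set.range fun y => ∑ x ∈ W.inputsOf y, P x) (W.maxMass P) := by
  have := W.nonempty_output
  exact ⟨exists_eq_ciSup_of_finite (f := fun y => ∑ x ∈ W.inputsOf y, P x),
    fun a ⟨y, hy⟩ => hy ▸ le_ciSup (f := fun y => ∑ x ∈ W.inputsOf y, P x)
      (Set.finite_range _).bddAbove y⟩

/-- The infimum in `piZero` is a minimum. -/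
theorem isLeast_piZero [Nonempty X] (W : DMC X Y) :
    IsLeast (W.maxMass '' stdSimplex ℝ X) W.piZero := by
  classical
  have := W.nonempty_output
  have hc : Continuous W.maxMass := by
    have h : W.maxMass = fun P => Finset.univ.sup' Finset.univ_nonempty
        (fun y => ∑ x ∈ W.inputsOf y, P x) := by
      funext P
      rw [Finset.sup'_univ_eq_ciSup]
      rfl
    rw [h]
    exact Continuous.finset_sup'_apply _ fun y _ => by fun_prop
  have hne : (stdSimplex ℝ X).Nonempty :=
    ⟨_, single_mem_stdSimplex ℝ (Classical.arbitrary X)⟩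
  exact ((isCompact_stdSimplex ℝ X).image hc).isLeast_sInf (hne.image _)

/-- `π₀ > 0`, so that its logarithm is meaningful. -/
theorem piZero_pos [Nonempty X] (W : DMC X Y) : 0 < W.piZero := by
  obtain ⟨P, hP, hPe⟩ := W.isLeast_piZero.1
  obtain ⟨x, hx⟩ : ∃ x, 0 < P x := by
    by_contra! h
    have := Finset.sum_nonpos fun x (_ : x ∈ Finset.univ) => h x
    linarith [hP.2]
  obtain ⟨y, hy⟩ : ∃ y, 0 < W.prob x y := by
    by_contra! h
    have := Finset.sum_nonpos fun y (_ : y ∈ Finset.univ) => h y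
    linarith [W.sum_prob x]
  rw [← hPe]
  refine lt_of_lt_of_le hx (le_trans ?_ ((W.isGreatest_maxMass P).2 ⟨y, rfl⟩))
  exact Finset.single_le_sum (f := P) (fun i _ => hP.1 i) (by simp [inputsOf, hy])

end DMC

/-! The list moment is at least 1, so a rate is achievable when the mean of `l ^ ρ - 1` can be made
to vanish. Since `l ^ ρ - 1` dominates `2 ^ ρ - 1` whenever `l ≥ 2`, a list moment tending to one
forces vanishing erasure probability, which gives the first claim.

Achievability rests on one random coding bound, `exists_code_of_cost_le`. Draw `M` codewords
independently from `Q`, and let `q` be the `Q`-mass of inputs compatible with the output. With base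
`1 + 1/(M q)`, each unsent codeword contributes the expected factor `1 + 1/M`, so any cost dominated
by `K * base ^ b`, with `b` the number of unsent messages on the list, has mean at most `e * E[K]`.
Three choices of `K` serve the three remaining claims. Moments of `q` multiply over product inputs
(`massMoment_prodMass`), so a strict inequality at one blocklength becomes exponential decay.

Positivity: uniform inputs have `E[q] < 1` as soon as two inputs differ in support; if none do,
every list is full. Limit at zero: feed the codewords of a good erasure code of length `N` into the
bound with small `ρ`. There `q = L/M`, so `E[q ^ ρ] ≤ M ^ (-ρ) * (1 - ε) + ε`, roughly `1 - ρ (1 -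
ε) log M`, and rates up to about `(1 - ε) log M / N` survive. Limit at infinity: powers of an
optimal `P` keep `q ≤ π₀ ^ n`, which achieves `-log π₀` for every `ρ`. Conversely some output has at
least `π₀ ^ n * M` messages on its list, and its probability decays only exponentially, at a speed
independent of `ρ`; the penalty is `K/ρ`. -/

/-! ### Random coding for a general cost of the list length. -/

/-- Expectation of a product of functions of independent, identically distributed codewords. -/
theorem sum_prod_codewords {ι Z : Type*} [Fintype ι] [DecidableEq ι] [Fintype Z] (Q : Z → ℝ)
    (g : ι → Z → ℝ) :
    ∑ f : ι → Z, (∏ i, Q (f i)) * ∏ i, g i (f i) = ∏ i, ∑ z, Q z * g i z := by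
  simp_rw [← Finset.prod_mul_distrib]
  rw [Finset.prod_univ_sum, Fintype.piFinset_univ]

/-- A point where a function does not exceed its weighted mean. -/
theorem exists_le_of_weighted_sum_le {F : Type*} [Fintype F] (w G : F → ℝ) (a : ℝ)
    (hw : ∀ f, 0 ≤ w f) (hw1 : ∑ f, w f = 1) (h : ∑ f, w f * G f ≤ a) : ∃ f, G f ≤ a := by
  by_contra! hlt
  have hsum : ∑ f, w f * (G f - a) ≤ 0 := by
    simp_rw [mul_sub, Finset.sum_sub_distrib, ← Finset.sum_mul, hw1]
    linarith
  have hnn : ∀ f ∈ Finset.univ, 0 ≤ w f * (G f - a) := fun f _ =>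
    mul_nonneg (hw f) (sub_nonneg.2 (hlt f).le)
  have hz := (Finset.sum_eq_zero_iff_of_nonneg hnn).1 (le_antisymm hsum (Finset.sum_nonneg hnn))
  have : ∀ f, w f = 0 := fun f => by
    rcases mul_eq_zero.1 (hz f (Finset.mem_univ f)) with h0 | h0
    · exact h0
    · linarith [hlt f]
  simp [this] at hw1

/-- Random coding: if the cost `φ` of a list length is dominated by a suitable geometric sequence
for each output, then some code has a small average cost. -/
theorem exists_code_of_cost_le {Z Ω : Type*} [Fintype Z] [Fintype Ω] (V : Z → Ω → ℝ)
    (hV : ∀ z ω, 0 ≤ V z ω) (Q : Z → ℝ) (hQ : Q ∈ stdSimplex ℝ Z) {M : ℕ} (hM : 0 < M)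
    (φ : ℕ → ℝ) (K : Ω → ℝ) (hK0 : ∀ ω, 0 ≤ K ω)
    (hK : ∀ ω, 0 < ∑ z with 0 < V z ω, Q z → ∀ b < M,
      φ (b + 1) ≤ K ω * (1 + ((M : ℝ) * ∑ z with 0 < V z ω, Q z)⁻¹) ^ b) :
    ∃ f : Fin M → Z, (M : ℝ)⁻¹ * ∑ m, ∑ ω, V (f m) ω *
        φ (Finset.univ.filter fun m' => 0 < V (f m') ω).card ≤
      Real.exp 1 * ∑ ω, (∑ z, Q z * V z ω) * K ω := by
  classical
  have hM' : (0 : ℝ) < M := by exact_mod_cast hM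
  set q : Ω → ℝ := fun ω => ∑ z with 0 < V z ω, Q z with hq
  -- Chosen so that a random codeword, compatible with probability `q ω`, contributes `1 + (c ω - 1)
  -- * q ω = 1 + 1/M` on average; the product over the other codewords then stays below `e`.
  set c : Ω → ℝ := fun ω => 1 + ((M : ℝ) * q ω)⁻¹ with hc
  have hq0 : ∀ ω, 0 ≤ q ω := fun ω => Finset.sum_nonneg fun z _ => hQ.1 z
  have hout : ∀ ω, 0 ≤ ∑ z, Q z * V z ω := fun ω =>
    Finset.sum_nonneg fun z _ => mul_nonneg (hQ.1 z) (hV z ω)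
  have hout0 : ∀ ω, q ω = 0 → ∑ z, Q z * V z ω = 0 := by
    intro ω h0
    refine Finset.sum_eq_zero fun z _ => ?_
    rcases (hV z ω).eq_or_lt with h | h
    · simp [← h]
    · have := (Finset.sum_eq_zero_iff_of_nonneg (fun z _ => hQ.1 z)).1 h0 z (by simp [h])
      simp [this]
  set w : (Fin M → Z) → ℝ := fun f => ∏ i, Q (f i) with hw
  have hw0 : ∀ f, 0 ≤ w f := fun f => Finset.prod_nonneg fun i _ => hQ.1 _
  have hw1 : ∑ f, w f = 1 := by
    have := sum_prod_codewords (ι := Fin M) Q (fun _ _ => 1)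
    simpa [hQ.2] using this
  refine exists_le_of_weighted_sum_le w _ _ hw0 hw1 ?_
  -- the cost is dominated by a product of functions of the codewords
  let g : Fin M → Ω → Fin M → Z → ℝ := fun m ω i z =>
    if i = m then V z ω else if 0 < V z ω then c ω else 1
  have hpt : ∀ f m ω, w f * (V (f m) ω *
      φ (Finset.univ.filter fun m' => 0 < V (f m') ω).card) ≤
      K ω * (w f * ∏ i, g m ω i (f i)) := by
    intro f m ω
    have hg : ∏ i, g m ω i (f i) = V (f m) ω *
        c ω ^ ((Finset.univ.filter fun m' => 0 < V (f m') ω).erase m).card := by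
      rw [← Finset.mul_prod_erase _ _ (Finset.mem_univ m)]
      congr 1
      · simp [g]
      · rw [← Finset.prod_const, ← Finset.filter_erase, Finset.prod_filter]
        refine Finset.prod_congr rfl fun i hi => ?_
        simp [g, (Finset.mem_erase.1 hi).1]
    rw [hg]
    rcases (hV (f m) ω).eq_or_lt with h | h
    · simp [← h]
    rcases (hw0 f).eq_or_lt with h' | h'
    · simp [← h']
    have hmem : m ∈ Finset.univ.filter fun m' => 0 < V (f m') ω := by simp [h]
    -- Positive weight of the code puts the sent codeword in the support of `Q`; this makes `q ω`
    -- positive, as the domination hypothesis requires.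
    have hQm : 0 < Q (f m) := by
      refine (hQ.1 _).lt_of_ne fun h0 => h'.ne' ?_
      exact Finset.prod_eq_zero (Finset.mem_univ m) h0.symm
    have hqpos : 0 < q ω := lt_of_lt_of_le hQm
      (Finset.single_le_sum (f := Q) (fun i _ => hQ.1 i) (by simp [h]))
    have hcard := Finset.card_erase_add_one hmem
    have hle : (Finset.univ.filter fun m' => 0 < V (f m') ω).card ≤ M := by
      simpa using Finset.card_le_univ (Finset.univ.filter fun m' => 0 < V (f m') ω)
    have := hK ω hqpos _ (by omega :
      ((Finset.univ.filter fun m' => 0 < V (f m') ω).erase m).card < M)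
    rw [hcard] at this
    calc _ ≤ w f * (V (f m) ω * (K ω * c ω ^ _)) := by gcongr
      _ = _ := by ring
  have hexp : ∀ m ω, ∑ f, w f * ∏ i, g m ω i (f i) ≤ Real.exp 1 * ∑ z, Q z * V z ω := by
    intro m ω
    rw [sum_prod_codewords, ← Finset.mul_prod_erase _ _ (Finset.mem_univ m)]
    have h1 : ∑ z, Q z * g m ω m z = ∑ z, Q z * V z ω := by simp [g]
    rw [h1, mul_comm]
    rcases (hq0 ω).eq_or_lt with h | h
    · rw [hout0 ω h.symm]; simp
    gcongr
    · exact hout ω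
    have h2 : ∀ i ∈ Finset.univ.erase m, ∑ z, Q z * g m ω i z = 1 + (M : ℝ)⁻¹ := by
      intro i hi
      have : ∀ z, Q z * g m ω i z = Q z + (c ω - 1) * (if 0 < V z ω then Q z else 0) := by
        intro z
        simp only [g, (Finset.mem_erase.1 hi).1, if_false]
        split_ifs <;> ring
      simp_rw [this, Finset.sum_add_distrib, ← Finset.mul_sum, ← Finset.sum_filter, hQ.2]
      change 1 + (1 + ((M : ℝ) * q ω)⁻¹ - 1) * q ω = _
      field_simp
      ring
    rw [Finset.prod_congr rfl h2, Finset.prod_const, Finset.card_erase_of_mem (Finset.mem_univ m)]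
    have hb : (1 : ℝ) + (M : ℝ)⁻¹ ≤ Real.exp (M : ℝ)⁻¹ := by
      linarith [Real.add_one_le_exp (M : ℝ)⁻¹]
    calc (1 + (M : ℝ)⁻¹) ^ (Finset.card (Finset.univ : Finset (Fin M)) - 1)
        ≤ (1 + (M : ℝ)⁻¹) ^ M := by
          refine pow_le_pow_right₀ ?_ (by simp)
          have : (0 : ℝ) ≤ (M : ℝ)⁻¹ := by positivity
          linarith
      _ ≤ (Real.exp (M : ℝ)⁻¹) ^ M := by gcongr
      _ = Real.exp 1 := by rw [← Real.exp_nat_mul, mul_inv_cancel₀ hM'.ne']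
  calc ∑ f, w f * ((M : ℝ)⁻¹ * ∑ m, ∑ ω, V (f m) ω *
        φ (Finset.univ.filter fun m' => 0 < V (f m') ω).card)
      = (M : ℝ)⁻¹ * ∑ m, ∑ ω, ∑ f, w f * (V (f m) ω *
        φ (Finset.univ.filter fun m' => 0 < V (f m') ω).card) := by
        simp_rw [mul_left_comm (w _) (M : ℝ)⁻¹]
        rw [← Finset.mul_sum]
        congr 1
        simp_rw [Finset.mul_sum]
        rw [Finset.sum_comm]
        exact Finset.sum_congr rfl fun m _ => Finset.sum_comm
    _ ≤ (M : ℝ)⁻¹ * ∑ m : Fin M, ∑ ω, K ω * (Real.exp 1 * ∑ z, Q z * V z ω) := by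
        gcongr with m _ ω _
        refine (Finset.sum_le_sum fun f _ => hpt f m ω).trans ?_
        rw [← Finset.mul_sum]
        exact mul_le_mul_of_nonneg_left (hexp m ω) (hK0 ω)
    _ = Real.exp 1 * ∑ ω, (∑ z, Q z * V z ω) * K ω := by
        rw [Finset.sum_const, Finset.card_univ, Fintype.card_fin, nsmul_eq_mul,
          inv_mul_cancel_left₀ hM'.ne', Finset.mul_sum]
        exact Finset.sum_congr rfl fun ω _ => by ring

namespace DMC

variable {X Y : Type*} [Fintype X] [Fintype Y]

/-! ### Block channel and multiplicativity of the mass moments. -/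

theorem blockProb_nonneg (W : DMC X Y) {n : ℕ} (x : Fin n → X) (y : Fin n → Y) :
    0 ≤ W.blockProb x y :=
  Finset.prod_nonneg fun _ _ => W.prob_nonneg _ _

theorem blockProb_pos_iff (W : DMC X Y) {n : ℕ} {x : Fin n → X} {y : Fin n → Y} :
    0 < W.blockProb x y ↔ ∀ i, 0 < W.prob (x i) (y i) := by
  refine ⟨fun h i => ?_, fun h => Finset.prod_pos fun i _ => h i⟩
  refine (W.prob_nonneg _ _).lt_of_ne fun h0 => h.ne' ?_
  exact Finset.prod_eq_zero (Finset.mem_univ i) h0.symm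

theorem sum_blockProb (W : DMC X Y) {n : ℕ} (x : Fin n → X) : ∑ y, W.blockProb x y = 1 := by
  classical
  have := Finset.prod_univ_sum (fun _ : Fin n => (Finset.univ : Finset Y))
    (fun i y => W.prob (x i) y)
  rw [Fintype.piFinset_univ] at this
  simp only [blockProb, ← this, W.sum_prob, Finset.prod_const_one]

theorem blockProb_append (W : DMC X Y) {m n : ℕ} (x : Fin m → X) (x' : Fin n → X)
    (y : Fin m → Y) (y' : Fin n → Y) :
    W.blockProb (Fin.append x x') (Fin.append y y') = W.blockProb x y * W.blockProb x' y' := by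
  simp [blockProb, Fin.prod_univ_add]

theorem blockProb_append_pos_iff (W : DMC X Y) {m n : ℕ} {x : Fin m → X} {x' : Fin n → X}
    {y : Fin m → Y} {y' : Fin n → Y} :
    0 < W.blockProb (Fin.append x x') (Fin.append y y') ↔
      0 < W.blockProb x y ∧ 0 < W.blockProb x' y' := by
  rw [blockProb_append]
  refine ⟨fun h => ?_, fun h => mul_pos h.1 h.2⟩
  exact ⟨pos_of_mul_pos_left h (W.blockProb_nonneg _ _),
    pos_of_mul_pos_right h (W.blockProb_nonneg _ _)⟩

/-- The output law induced by the input weights `Q`. -/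
def outMass (W : DMC X Y) {n : ℕ} (Q : (Fin n → X) → ℝ) (y : Fin n → Y) : ℝ :=
  ∑ x, Q x * W.blockProb x y

/-- The total weight of the input sequences that can produce `y`. -/
noncomputable def listMass (W : DMC X Y) {n : ℕ} (Q : (Fin n → X) → ℝ) (y : Fin n → Y) : ℝ :=
  ∑ x with 0 < W.blockProb x y, Q x

/-- The expected `s`-th power of the weight of the input sequences that can produce the output. -/
noncomputable def massMoment (W : DMC X Y) (s : ℝ) {n : ℕ} (Q : (Fin n → X) → ℝ) : ℝ :=
  ∑ y, W.outMass Q y * W.listMass Q y ^ s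

theorem outMass_nonneg (W : DMC X Y) {n : ℕ} {Q : (Fin n → X) → ℝ}
    (hQ : Q ∈ stdSimplex ℝ (Fin n → X)) (y : Fin n → Y) : 0 ≤ W.outMass Q y :=
  Finset.sum_nonneg fun x _ => mul_nonneg (hQ.1 x) (W.blockProb_nonneg _ _)

theorem sum_outMass (W : DMC X Y) {n : ℕ} {Q : (Fin n → X) → ℝ}
    (hQ : Q ∈ stdSimplex ℝ (Fin n → X)) : ∑ y, W.outMass Q y = 1 := by
  simp only [outMass]
  rw [Finset.sum_comm]
  simp_rw [← Finset.mul_sum, sum_blockProb, mul_one]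
  exact hQ.2

theorem listMass_nonneg (W : DMC X Y) {n : ℕ} {Q : (Fin n → X) → ℝ}
    (hQ : Q ∈ stdSimplex ℝ (Fin n → X)) (y : Fin n → Y) : 0 ≤ W.listMass Q y :=
  Finset.sum_nonneg fun x _ => hQ.1 x

theorem listMass_le_one (W : DMC X Y) {n : ℕ} {Q : (Fin n → X) → ℝ}
    (hQ : Q ∈ stdSimplex ℝ (Fin n → X)) (y : Fin n → Y) : W.listMass Q y ≤ 1 := by
  rw [← hQ.2]
  exact Finset.sum_le_sum_of_subset_of_nonneg (Finset.filter_subset _ _) fun x _ _ => hQ.1 x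

theorem massMoment_nonneg (W : DMC X Y) (s : ℝ) {n : ℕ} {Q : (Fin n → X) → ℝ}
    (hQ : Q ∈ stdSimplex ℝ (Fin n → X)) : 0 ≤ W.massMoment s Q :=
  Finset.sum_nonneg fun y _ =>
    mul_nonneg (W.outMass_nonneg hQ y) (Real.rpow_nonneg (W.listMass_nonneg hQ y) _)

theorem massMoment_le_one (W : DMC X Y) {s : ℝ} (hs : 0 ≤ s) {n : ℕ} {Q : (Fin n → X) → ℝ}
    (hQ : Q ∈ stdSimplex ℝ (Fin n → X)) : W.massMoment s Q ≤ 1 := by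
  rw [← W.sum_outMass hQ]
  exact Finset.sum_le_sum fun y _ => mul_le_of_le_one_right (W.outMass_nonneg hQ y)
    (Real.rpow_le_one (W.listMass_nonneg hQ y) (W.listMass_le_one hQ y) hs)

theorem sum_append {A : Type*} [Fintype A] {m n : ℕ} (F : (Fin (m + n) → A) → ℝ) :
    ∑ x, F x = ∑ x : Fin m → A, ∑ x' : Fin n → A, F (Fin.append x x') := by
  rw [← (Fin.appendEquiv m n).sum_comp, Fintype.sum_prod_type]
  rfl

/-- The product of weights on input sequences. -/
def prodMass {A : Type*} {m n : ℕ} (Q : (Fin m → A) → ℝ) (Q' : (Fin n → A) → ℝ)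
    (x : Fin (m + n) → A) : ℝ :=
  Q (fun i => x (Fin.castAdd n i)) * Q' fun i => x (Fin.natAdd m i)

theorem prodMass_append {A : Type*} {m n : ℕ} (Q : (Fin m → A) → ℝ) (Q' : (Fin n → A) → ℝ)
    (x : Fin m → A) (x' : Fin n → A) : prodMass Q Q' (Fin.append x x') = Q x * Q' x' := by
  simp [prodMass]

theorem prodMass_mem {m n : ℕ} {Q : (Fin m → X) → ℝ} {Q' : (Fin n → X) → ℝ}
    (hQ : Q ∈ stdSimplex ℝ (Fin m → X)) (hQ' : Q' ∈ stdSimplex ℝ (Fin n → X)) :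
    prodMass Q Q' ∈ stdSimplex ℝ (Fin (m + n) → X) := by
  refine ⟨fun x => mul_nonneg (hQ.1 _) (hQ'.1 _), ?_⟩
  rw [sum_append]
  simp_rw [prodMass_append, ← Finset.mul_sum, hQ'.2, mul_one]
  exact hQ.2

theorem outMass_prodMass (W : DMC X Y) {m n : ℕ} (Q : (Fin m → X) → ℝ) (Q' : (Fin n → X) → ℝ)
    (y : Fin m → Y) (y' : Fin n → Y) :
    W.outMass (prodMass Q Q') (Fin.append y y') = W.outMass Q y * W.outMass Q' y' := by
  simp only [outMass]
  rw [sum_append, Finset.sum_mul_sum]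
  refine Finset.sum_congr rfl fun x _ => Finset.sum_congr rfl fun x' _ => ?_
  rw [prodMass_append, blockProb_append]
  ring

theorem listMass_prodMass (W : DMC X Y) {m n : ℕ} (Q : (Fin m → X) → ℝ) (Q' : (Fin n → X) → ℝ)
    (y : Fin m → Y) (y' : Fin n → Y) :
    W.listMass (prodMass Q Q') (Fin.append y y') = W.listMass Q y * W.listMass Q' y' := by
  simp only [listMass]
  rw [Finset.sum_filter, sum_append, Finset.sum_filter, Finset.sum_filter, Finset.sum_mul_sum]
  refine Finset.sum_congr rfl fun x _ => Finset.sum_congr rfl fun x' _ => ?_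
  rw [prodMass_append]
  by_cases h : 0 < W.blockProb x y <;> by_cases h' : 0 < W.blockProb x' y' <;>
    simp [blockProb_append_pos_iff, h, h']

theorem massMoment_prodMass (W : DMC X Y) (s : ℝ) {m n : ℕ} {Q : (Fin m → X) → ℝ}
    {Q' : (Fin n → X) → ℝ}
    (hQ : Q ∈ stdSimplex ℝ (Fin m → X)) (hQ' : Q' ∈ stdSimplex ℝ (Fin n → X)) :
    W.massMoment s (prodMass Q Q') = W.massMoment s Q * W.massMoment s Q' := by
  simp only [massMoment]
  rw [sum_append, Finset.sum_mul_sum]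
  refine Finset.sum_congr rfl fun y _ => Finset.sum_congr rfl fun y' _ => ?_
  rw [outMass_prodMass, listMass_prodMass,
    Real.mul_rpow (W.listMass_nonneg hQ y) (W.listMass_nonneg hQ' y')]
  ring

/-- A mass function on some `X ^ n` can be extended to all longer blocklengths. -/
theorem exists_massMoment_le [Nonempty X] (W : DMC X Y) {s : ℝ} (hs : 0 ≤ s) {N : ℕ}
    {Q : (Fin N → X) → ℝ} (hQ : Q ∈ stdSimplex ℝ (Fin N → X)) (k r n : ℕ) (hn : n = r + N * k) :
    ∃ Q' ∈ stdSimplex ℝ (Fin n → X), W.massMoment s Q' ≤ W.massMoment s Q ^ k := by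
  classical
  induction k generalizing n with
  | zero =>
    -- The `r` leftover positions carry a point mass, whose moment is at most 1.
    refine ⟨_, single_mem_stdSimplex ℝ fun _ => Classical.arbitrary X, ?_⟩
    simpa using W.massMoment_le_one hs (single_mem_stdSimplex ℝ _)
  | succ k ih =>
    obtain ⟨Q', hQ', h⟩ := ih _ rfl
    obtain rfl : n = (r + N * k) + N := by rw [hn, Nat.mul_succ, Nat.add_assoc]
    refine ⟨prodMass Q' Q, prodMass_mem hQ' hQ, ?_⟩
    rw [W.massMoment_prodMass s hQ' hQ, pow_succ]
    exact mul_le_mul_of_nonneg_right h (W.massMoment_nonneg s hQ)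

/-! ### The role of `π₀`: small list masses and unavoidable long lists. -/

theorem listMass_comp_zero (W : DMC X Y) (P : X → ℝ) (y : Fin 1 → Y) :
    W.listMass (fun x : Fin 1 → X => P (x 0)) y = ∑ x ∈ W.inputsOf (y 0), P x := by
  simp only [listMass, inputsOf, Finset.sum_filter]
  rw [← (Equiv.funUnique (Fin 1) X).sum_comp]
  refine Finset.sum_congr rfl fun x _ => ?_
  simp [blockProb]

theorem comp_zero_mem {P : X → ℝ} (hP : P ∈ stdSimplex ℝ X) :
    (fun x : Fin 1 → X => P (x 0)) ∈ stdSimplex ℝ (Fin 1 → X) := by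
  refine ⟨fun x => hP.1 _, ?_⟩
  rw [← hP.2, ← (Equiv.funUnique (Fin 1) X).sum_comp]
  rfl

/-- The product of `n` copies of a minimiser `P` works, since list masses factor over letters. -/
theorem exists_listMass_le_piZero_pow [Nonempty X] (W : DMC X Y) (n : ℕ) :
    ∃ Q ∈ stdSimplex ℝ (Fin n → X), ∀ y, W.listMass Q y ≤ W.piZero ^ n := by
  classical
  induction n with
  | zero =>
    refine ⟨_, single_mem_stdSimplex ℝ fun _ => Classical.arbitrary X, fun y => ?_⟩
    simpa using W.listMass_le_one (single_mem_stdSimplex ℝ _) y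
  | succ n ih =>
    obtain ⟨Q, hQ, h⟩ := ih
    obtain ⟨P, hP, hPe⟩ := W.isLeast_piZero.1
    refine ⟨_, prodMass_mem hQ (comp_zero_mem hP), fun y => ?_⟩
    obtain ⟨⟨y₁, y₂⟩, rfl⟩ := (Fin.appendEquiv n 1).surjective y
    change W.listMass _ (Fin.append y₁ y₂) ≤ _
    rw [listMass_prodMass, pow_succ, listMass_comp_zero]
    refine mul_le_mul (h _) ?_ (Finset.sum_nonneg fun x _ => hP.1 x)
      (pow_nonneg W.piZero_pos.le _)
    rw [← hPe]
    exact (W.isGreatest_maxMass P).2 ⟨y₂ 0, rfl⟩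

/-- Every list of input sequences has a large sublist compatible with one output sequence. -/
theorem exists_output_card_ge [Nonempty X] (W : DMC X Y) {ι : Type*} (n : ℕ) :
    ∀ (S : Finset ι) (f : ι → Fin n → X), ∃ y : Fin n → Y,
      W.piZero ^ n * S.card ≤ (S.filter fun m => 0 < W.blockProb (f m) y).card := by
  classical
  have hπ := W.piZero_pos
  induction n with
  | zero =>
    intro S f
    exact ⟨Fin.elim0, by simp [blockProb]⟩
  | succ n ih =>
    intro S f
    rcases S.eq_empty_or_nonempty with rfl | hS
    · have := W.nonempty_output
      exact ⟨fun _ => Classical.arbitrary Y, by simp⟩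
    have hSc : (0 : ℝ) < S.card := by exact_mod_cast hS.card_pos
    -- Empirical law of the first letters in `S`. By minimality of `π₀`, some `y₀` is compatible
    -- with at least a fraction `π₀` of `S`; the induction continues on the tails of the survivors.
    let P : X → ℝ := fun x => (S.card : ℝ)⁻¹ * (S.filter fun m => f m 0 = x).card
    have hP : P ∈ stdSimplex ℝ X := by
      refine ⟨fun x => by positivity, ?_⟩
      rw [← Finset.mul_sum, ← Nat.cast_sum, ← Finset.card_eq_sum_card_fiberwise
        (fun m _ => Finset.mem_coe.2 (Finset.mem_univ (f m 0))), inv_mul_cancel₀ hSc.ne']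
    obtain ⟨y₀, hy₀⟩ := (W.isGreatest_maxMass P).1
    have hle : W.piZero ≤ W.maxMass P := W.isLeast_piZero.2 ⟨P, hP, rfl⟩
    obtain ⟨y, hy⟩ := ih (S.filter fun m => 0 < W.prob (f m 0) y₀) fun m i => f m i.succ
    refine ⟨Fin.cons y₀ y, ?_⟩
    have hfil : (S.filter fun m => 0 < W.blockProb (f m) (Fin.cons y₀ y : Fin (n + 1) → Y)) =
        (S.filter fun m => 0 < W.prob (f m 0) y₀).filter
          fun m => 0 < W.blockProb (fun i => f m i.succ) y := by
      rw [Finset.filter_filter]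
      refine Finset.filter_congr fun m _ => ?_
      simp [blockProb_pos_iff, Fin.forall_fin_succ]
    have hmass : (S.card : ℝ) * W.maxMass P = (S.filter fun m => 0 < W.prob (f m 0) y₀).card := by
      rw [← hy₀]
      simp only [P]
      rw [← Finset.mul_sum, mul_inv_cancel_left₀ hSc.ne', ← Nat.cast_sum,
        Finset.card_eq_sum_card_fiberwise (t := W.inputsOf y₀) (f := fun m => f m 0)]
      · congr 1
        refine Finset.sum_congr rfl fun x hx => ?_
        rw [Finset.filter_filter]
        congr 1
        refine Finset.filter_congr fun m _ => ?_
        have : 0 < W.prob x y₀ := by simpa [inputsOf] using hx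
        constructor
        · rintro rfl; exact ⟨this, rfl⟩
        · exact fun h => h.2
      · intro m hm
        have := (Finset.mem_filter.1 (Finset.mem_coe.1 hm)).2
        simpa [inputsOf] using this
    rw [hfil]
    refine le_trans ?_ hy
    rw [← hmass, pow_succ, mul_assoc]
    gcongr _ * ?_
    rw [mul_comm]
    gcongr

/-! ### List moments against erasure probability. -/

theorem floor_exp_pos {n : ℕ} {R : ℝ} (hR : 0 ≤ R) : 0 < ⌊Real.exp (n * R)⌋₊ :=
  Nat.floor_pos.2 (Real.one_le_exp (by positivity))

theorem floor_exp_le (n : ℕ) (R : ℝ) : (⌊Real.exp (n * R)⌋₊ : ℝ) ≤ Real.exp (n * R) :=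
  Nat.floor_le (Real.exp_pos _).le

theorem exp_le_two_mul_floor_exp {n : ℕ} {R : ℝ} (hR : 0 ≤ R) :
    Real.exp (n * R) ≤ 2 * (⌊Real.exp (n * R)⌋₊ : ℝ) := by
  have h1 := Nat.lt_floor_add_one (Real.exp (n * R))
  have h2 : (1 : ℝ) ≤ ⌊Real.exp (n * R)⌋₊ := by exact_mod_cast floor_exp_pos hR
  linarith

theorem card_messageList_le (W : DMC X Y) {n : ℕ} {R : ℝ} (f : Encoder X n R) (y : Fin n → Y) :
    (W.messageList f y).card ≤ ⌊Real.exp (n * R)⌋₊ := by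
  simpa using Finset.card_le_univ (W.messageList f y)

theorem one_le_card_messageList (W : DMC X Y) {n : ℕ} {R : ℝ} (f : Encoder X n R)
    {y : Fin n → Y} {m} (h : 0 < W.blockProb (f m) y) : 1 ≤ (W.messageList f y).card :=
  Finset.card_pos.2 ⟨m, by simp [messageList, h]⟩

/-- The probability that the list is longer than one, as a sum over all outputs. -/
theorem erasureProb_eq (W : DMC X Y) {n : ℕ} {R : ℝ} (f : Encoder X n R) :
    W.erasureProb f = (⌊Real.exp (n * R)⌋₊ : ℝ)⁻¹ * ∑ m, ∑ y, W.blockProb (f m) y *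
      (if 2 ≤ (W.messageList f y).card then 1 else 0) := by
  simp [erasureProb, Finset.sum_filter]

theorem erasureProb_nonneg (W : DMC X Y) {n : ℕ} {R : ℝ} (f : Encoder X n R) :
    0 ≤ W.erasureProb f :=
  mul_nonneg (by positivity) (Finset.sum_nonneg fun m _ => Finset.sum_nonneg fun y _ =>
    W.blockProb_nonneg _ _)

theorem average_add_mul (W : DMC X Y) {n : ℕ} {R : ℝ} (hR : 0 ≤ R) (f : Encoder X n R)
    (a b : ℝ) (F : (Fin n → Y) → ℝ) :
    (⌊Real.exp (n * R)⌋₊ : ℝ)⁻¹ * ∑ m, ∑ y, W.blockProb (f m) y * (a + b * F y) =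
      a + b * ((⌊Real.exp (n * R)⌋₊ : ℝ)⁻¹ * ∑ m, ∑ y, W.blockProb (f m) y * F y) := by
  have hM : (⌊Real.exp (n * R)⌋₊ : ℝ) ≠ 0 := by exact_mod_cast (floor_exp_pos hR).ne'
  have : ∀ (m) (y : Fin n → Y), W.blockProb (f m) y * (a + b * F y) =
      W.blockProb (f m) y * a + b * (W.blockProb (f m) y * F y) := fun m y => by ring
  simp_rw [this, Finset.sum_add_distrib, ← Finset.sum_mul, sum_blockProb, ← Finset.mul_sum]
  simp only [Finset.sum_const, Finset.card_univ, Fintype.card_fin, nsmul_eq_mul]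
  field_simp

/-- The sent message is on the list of every output of positive probability, so only lengths between
1 and `M` matter. -/
theorem average_mono (W : DMC X Y) {n : ℕ} {R : ℝ} (f : Encoder X n R)
    {F G : ℕ → ℝ} (h : ∀ l, 1 ≤ l → l ≤ ⌊Real.exp (n * R)⌋₊ → F l ≤ G l) :
    (⌊Real.exp (n * R)⌋₊ : ℝ)⁻¹ * ∑ m, ∑ y, W.blockProb (f m) y * F (W.messageList f y).card ≤
    (⌊Real.exp (n * R)⌋₊ : ℝ)⁻¹ * ∑ m, ∑ y, W.blockProb (f m) y * G (W.messageList f y).card := by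
  refine mul_le_mul_of_nonneg_left (Finset.sum_le_sum fun m _ => Finset.sum_le_sum fun y _ => ?_)
    (by positivity)
  rcases (W.blockProb_nonneg (f m) y).eq_or_lt with h0 | h0
  · simp [← h0]
  · exact mul_le_mul_of_nonneg_left
      (h _ (W.one_le_card_messageList f h0) (W.card_messageList_le f y)) h0.le

theorem one_add_erasureProb_le_listMoment (W : DMC X Y) {ρ : ℝ} (hρ : 0 ≤ ρ) {n : ℕ} {R : ℝ}
    (hR : 0 ≤ R) (f : Encoder X n R) :
    1 + (2 ^ ρ - 1) * W.erasureProb f ≤ W.listMoment ρ f := by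
  rw [erasureProb_eq, ← W.average_add_mul hR f 1 (2 ^ ρ - 1)
    fun y => if 2 ≤ (W.messageList f y).card then 1 else 0]
  refine W.average_mono f (F := fun l => 1 + (2 ^ ρ - 1) * if 2 ≤ l then 1 else 0)
    (G := fun l => (l : ℝ) ^ ρ) fun l h1 _ => ?_
  have h1' : (1 : ℝ) ≤ l := by exact_mod_cast h1
  split_ifs with h2
  · have : (2 : ℝ) ≤ l := by exact_mod_cast h2
    have := Real.rpow_le_rpow (by norm_num) this hρ
    linarith
  · simpa using Real.one_le_rpow h1' hρ

theorem listMoment_le_of_erasureProb (W : DMC X Y) {ρ : ℝ} (hρ : 0 ≤ ρ) {n : ℕ} {R : ℝ}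
    (hR : 0 ≤ R) (f : Encoder X n R) :
    W.listMoment ρ f ≤ 1 + ((⌊Real.exp (n * R)⌋₊ : ℝ) ^ ρ - 1) * W.erasureProb f := by
  rw [erasureProb_eq, ← W.average_add_mul hR f 1 _
    fun y => if 2 ≤ (W.messageList f y).card then 1 else 0]
  refine W.average_mono f (F := fun l => (l : ℝ) ^ ρ)
    (G := fun l => 1 + ((⌊Real.exp (n * R)⌋₊ : ℝ) ^ ρ - 1) * if 2 ≤ l then 1 else 0)
    fun l h1 h => ?_
  split_ifs with h2
  · have : (l : ℝ) ≤ ⌊Real.exp (n * R)⌋₊ := by exact_mod_cast h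
    have := Real.rpow_le_rpow (by positivity) this hρ
    linarith
  · obtain rfl : l = 1 := by omega
    simp

theorem one_le_listMoment (W : DMC X Y) {ρ : ℝ} (hρ : 0 ≤ ρ) {n : ℕ} {R : ℝ}
    (hR : 0 ≤ R) (f : Encoder X n R) : 1 ≤ W.listMoment ρ f := by
  refine le_trans ?_ (W.one_add_erasureProb_le_listMoment hρ hR f)
  have := mul_nonneg (sub_nonneg.2 (Real.one_le_rpow (by norm_num : (1 : ℝ) ≤ 2) hρ))
    (W.erasureProb_nonneg f)
  linarith

theorem listMoment_mono (W : DMC X Y) {ρ ρ' : ℝ} (h : ρ ≤ ρ') {n : ℕ} {R : ℝ}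
    (f : Encoder X n R) : W.listMoment ρ f ≤ W.listMoment ρ' f :=
  W.average_mono f (F := fun l => (l : ℝ) ^ ρ) (G := fun l => (l : ℝ) ^ ρ') fun l h1 _ =>
    Real.rpow_le_rpow_of_exponent_le (by exact_mod_cast h1) h

/-- Finitely many blocklengths do not affect the limit; arbitrary encoders fill them, which is where
`Nonempty X` enters. -/
theorem mem_listRates (W : DMC X Y) {ρ : ℝ} (hρ : 0 ≤ ρ) {R : ℝ} (hR : 0 ≤ R) {u : ℕ → ℝ}
    (hu : Tendsto u atTop (𝓝 0))
    (h : ∀ᶠ n in atTop, ∃ f : Encoder X n R, W.listMoment ρ f ≤ 1 + u n) [Nonempty X] :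
    R ∈ W.listRates ρ := by
  have h' : ∀ᶠ n in atTop, ∃ f : Encoder X (n + 1) R, W.listMoment ρ f ≤ 1 + u (n + 1) :=
    (tendsto_add_atTop_nat 1).eventually h
  rw [eventually_atTop] at h'
  obtain ⟨n₀, hn₀⟩ := h'
  choose! g hg using hn₀
  refine ⟨hR, g, ?_⟩
  have hu' : Tendsto (fun n => 1 + u (n + 1)) atTop (𝓝 1) := by
    simpa using (hu.comp (tendsto_add_atTop_nat 1)).const_add 1
  refine tendsto_of_tendsto_of_tendsto_of_le_of_le' tendsto_const_nhds hu'
    (Eventually.of_forall fun n => W.one_le_listMoment hρ hR _) ?_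
  exact eventually_atTop.2 ⟨n₀, hg⟩

theorem listRates_anti (W : DMC X Y) {ρ ρ' : ℝ} (hρ : 0 ≤ ρ) (h : ρ ≤ ρ') :
    W.listRates ρ' ⊆ W.listRates ρ := by
  rintro R ⟨hR, f, hf⟩
  exact ⟨hR, f, tendsto_of_tendsto_of_tendsto_of_le_of_le tendsto_const_nhds hf
    (fun n => W.one_le_listMoment hρ hR _) fun n => W.listMoment_mono h _⟩

theorem listCapacity_anti (W : DMC X Y) {ρ ρ' : ℝ} (hρ : 0 ≤ ρ) (h : ρ ≤ ρ') :
    W.listCapacity ρ' ≤ W.listCapacity ρ :=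
  biSup_mono fun _ hR => W.listRates_anti hρ h hR

theorem listRates_subset_zueRates (W : DMC X Y) {ρ : ℝ} (hρ : 0 < ρ) :
    W.listRates ρ ⊆ W.zueRates := by
  rintro R ⟨hR, f, hf⟩
  refine ⟨hR, f, ?_⟩
  have hc : 0 < (2 : ℝ) ^ ρ - 1 := sub_pos.2 (Real.one_lt_rpow (by norm_num) hρ)
  have hlim : Tendsto (fun n => (W.listMoment ρ (f n) - 1) / ((2 : ℝ) ^ ρ - 1)) atTop (𝓝 0) := by
    simpa using (hf.sub_const 1).div_const ((2 : ℝ) ^ ρ - 1)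
  refine squeeze_zero (fun n => W.erasureProb_nonneg _) (fun n => ?_) hlim
  rw [le_div_iff₀ hc, mul_comm]
  linarith [W.one_add_erasureProb_le_listMoment hρ.le hR (f n)]

theorem listCapacity_le_zueCapacity (W : DMC X Y) {ρ : ℝ} (hρ : 0 < ρ) :
    W.listCapacity ρ ≤ W.zueCapacity :=
  biSup_mono fun _ hR => W.listRates_subset_zueRates hρ hR

theorem zero_mem_listRates [Nonempty X] (W : DMC X Y) {ρ : ℝ} (hρ : 0 ≤ ρ) :
    0 ∈ W.listRates ρ := by
  refine W.mem_listRates hρ le_rfl tendsto_const_nhds (Eventually.of_forall fun n => ?_)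
  refine ⟨fun _ _ => Classical.arbitrary X, ?_⟩
  refine (W.listMoment_le_of_erasureProb hρ le_rfl _).trans ?_
  -- At rate 0 there is a single message, so the coefficient `1 ^ ρ - 1` vanishes.
  simp

theorem listCapacity_nonneg [Nonempty X] (W : DMC X Y) {ρ : ℝ} (hρ : 0 ≤ ρ) :
    0 ≤ W.listCapacity ρ :=
  le_biSup (fun R : ℝ => (R : EReal)) (W.zero_mem_listRates hρ)

/-! ### Achievability. -/

/-- The random coding bound for the moments of the list length. -/
theorem exists_listMoment_le (W : DMC X Y) (ρ : ℝ) {n : ℕ} {R : ℝ} (hR : 0 ≤ R)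
    {Q : (Fin n → X) → ℝ} (hQ : Q ∈ stdSimplex ℝ (Fin n → X)) (K : (Fin n → Y) → ℝ)
    (hK0 : ∀ y, 0 ≤ K y)
    (hK : ∀ y, 0 < W.listMass Q y → ∀ b < ⌊Real.exp (n * R)⌋₊,
      ((b : ℝ) + 1) ^ ρ - 1 ≤
        K y * (1 + ((⌊Real.exp (n * R)⌋₊ : ℝ) * W.listMass Q y)⁻¹) ^ b) :
    ∃ f : Encoder X n R, W.listMoment ρ f ≤ 1 + Real.exp 1 * ∑ y, W.outMass Q y * K y := by
  obtain ⟨f, hf⟩ := exists_code_of_cost_le (fun x y => W.blockProb x y) W.blockProb_nonneg Q hQ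
    (floor_exp_pos hR) (fun l => (l : ℝ) ^ ρ - 1) K hK0
    (fun y hy b hb => by rw [Nat.cast_add_one]; exact hK y hy b hb)
  refine ⟨f, ?_⟩
  have := W.average_add_mul hR f (-1) 1 fun y => ((W.messageList f y).card : ℝ) ^ ρ
  have h2 : (⌊Real.exp (n * R)⌋₊ : ℝ)⁻¹ * ∑ m, ∑ y, W.blockProb (f m) y *
      (-1 + 1 * ((W.messageList f y).card : ℝ) ^ ρ) ≤
      Real.exp 1 * ∑ y, W.outMass Q y * K y := by
    refine le_trans (le_of_eq ?_) hf
    refine congrArg _ (Finset.sum_congr rfl fun m _ => Finset.sum_congr rfl fun y _ => ?_)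
    rw [messageList]
    ring
  rw [this] at h2
  rw [listMoment]
  linarith

/-- With `μ = M q` and `K = μ ^ ρ`: subadditivity gives `(b + 1) ^ ρ - 1 ≤ b ^ ρ = μ ^ ρ * (b / μ) ^
ρ`, and for `ρ ≤ 1` Bernoulli absorbs the last factor. -/
theorem exists_listMoment_le_of_le_one (W : DMC X Y) {ρ : ℝ} (hρ : 0 < ρ) (hρ1 : ρ ≤ 1) {n : ℕ}
    {R : ℝ} (hR : 0 ≤ R) {Q : (Fin n → X) → ℝ} (hQ : Q ∈ stdSimplex ℝ (Fin n → X)) :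
    ∃ f : Encoder X n R, W.listMoment ρ f ≤
      1 + Real.exp 1 * (((⌊Real.exp (n * R)⌋₊ : ℝ)) ^ ρ * W.massMoment ρ Q) := by
  have hM : (0 : ℝ) < ⌊Real.exp (n * R)⌋₊ := by exact_mod_cast floor_exp_pos hR
  obtain ⟨f, hf⟩ := W.exists_listMoment_le ρ hR hQ
    (fun y => ((⌊Real.exp (n * R)⌋₊ : ℝ) * W.listMass Q y) ^ ρ)
    (fun y => Real.rpow_nonneg (mul_nonneg hM.le (W.listMass_nonneg hQ y)) _)
    (fun y hy b _ => by
      set μ := (⌊Real.exp (n * R)⌋₊ : ℝ) * W.listMass Q y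
      have hμ : 0 < μ := mul_pos hM hy
      have hb : (0 : ℝ) ≤ b := b.cast_nonneg
      have hx : 0 ≤ b * μ⁻¹ := by positivity
      calc ((b : ℝ) + 1) ^ ρ - 1 ≤ (b : ℝ) ^ ρ := by
            have := Real.rpow_add_le_add_rpow hb zero_le_one hρ.le hρ1
            rw [Real.one_rpow] at this
            linarith
        _ = μ ^ ρ * (b * μ⁻¹) ^ ρ := by
            rw [← Real.mul_rpow hμ.le hx]
            congr 1
            field_simp
        _ ≤ μ ^ ρ * (1 + b * μ⁻¹) ^ (1 : ℝ) := by
            gcongr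
            refine (Real.rpow_le_rpow hx (by linarith : b * μ⁻¹ ≤ 1 + b * μ⁻¹) hρ.le).trans ?_
            exact Real.rpow_le_rpow_of_exponent_le (by linarith) hρ1
        _ ≤ μ ^ ρ * (1 + μ⁻¹) ^ b := by
            rw [Real.rpow_one]
            gcongr
            exact one_add_mul_le_pow (by linarith [inv_pos.2 hμ]) b)
  refine ⟨f, hf.trans (le_of_eq ?_)⟩
  congr 2
  rw [massMoment, Finset.mul_sum]
  refine Finset.sum_congr rfl fun y _ => ?_
  rw [Real.mul_rpow hM.le (W.listMass_nonneg hQ y)]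
  ring

/-- A crude bound valid for every `ρ`: any list has at most `M` entries. The loss `M ^ ρ` is
harmless where only some positive rate is sought. -/
theorem exists_listMoment_le_massMoment_one (W : DMC X Y) {ρ : ℝ} (hρ : 0 < ρ) {n : ℕ}
    {R : ℝ} (hR : 0 ≤ R) {Q : (Fin n → X) → ℝ} (hQ : Q ∈ stdSimplex ℝ (Fin n → X)) :
    ∃ f : Encoder X n R, W.listMoment ρ f ≤
      1 + Real.exp 1 * (((⌊Real.exp (n * R)⌋₊ : ℝ)) ^ (ρ + 1) * W.massMoment 1 Q) := by
  have hM : (0 : ℝ) < ⌊Real.exp (n * R)⌋₊ := by exact_mod_cast floor_exp_pos hR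
  obtain ⟨f, hf⟩ := W.exists_listMoment_le ρ hR hQ
    (fun y => (⌊Real.exp (n * R)⌋₊ : ℝ) ^ ρ * ((⌊Real.exp (n * R)⌋₊ : ℝ) * W.listMass Q y))
    (fun y => mul_nonneg (by positivity) (mul_nonneg hM.le (W.listMass_nonneg hQ y)))
    (fun y hy b hbM => by
      set M := (⌊Real.exp (n * R)⌋₊ : ℝ)
      set μ := M * W.listMass Q y
      have hμ : 0 < μ := mul_pos hM hy
      rcases Nat.eq_zero_or_pos b with rfl | hb0
      · simp only [Nat.cast_zero, zero_add, Real.one_rpow, sub_self]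
        positivity
      have hb : (1 : ℝ) ≤ b := by exact_mod_cast hb0
      have hbM' : (b : ℝ) + 1 ≤ M := by simp only [M]; exact_mod_cast hbM
      calc ((b : ℝ) + 1) ^ ρ - 1 ≤ M ^ ρ := by
            have := Real.rpow_le_rpow (by positivity) hbM' hρ.le
            linarith
        _ ≤ M ^ ρ * b := le_mul_of_one_le_right (by positivity) hb
        _ = M ^ ρ * μ * (b * μ⁻¹) := by field_simp
        _ ≤ M ^ ρ * μ * (1 + μ⁻¹) ^ b := by
            gcongr
            linarith [one_add_mul_le_pow (by linarith [inv_pos.2 hμ] : -2 ≤ μ⁻¹) b])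
  refine ⟨f, hf.trans (le_of_eq ?_)⟩
  congr 2
  rw [massMoment, Finset.mul_sum]
  refine Finset.sum_congr rfl fun y _ => ?_
  rw [Real.rpow_one, Real.rpow_add_one hM.ne']
  ring

theorem exists_rpow_le_mul_two_pow (ρ : ℝ) :
    ∃ C : ℝ, 0 ≤ C ∧ ∀ b : ℕ, ((b : ℝ) + 1) ^ ρ ≤ C * 2 ^ b := by
  have h := tendsto_pow_const_div_const_pow_of_one_lt ⌈ρ⌉₊ (by norm_num : (1 : ℝ) < 2)
  obtain ⟨C, hC⟩ := h.bddAbove_range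
  have hC' : ∀ b : ℕ, ((b : ℝ) + 1) ^ ρ ≤ (2 * C) * 2 ^ b := fun b => by
    have h1 : ((b : ℝ) + 1) ^ ⌈ρ⌉₊ / 2 ^ (b + 1) ≤ C := by
      simpa using hC ⟨b + 1, rfl⟩
    rw [div_le_iff₀ (by positivity), pow_succ] at h1
    have h2 : ((b : ℝ) + 1) ^ ρ ≤ ((b : ℝ) + 1) ^ ⌈ρ⌉₊ := by
      rw [← Real.rpow_natCast]
      exact Real.rpow_le_rpow_of_exponent_le (by linarith [b.cast_nonneg (α := ℝ)])
        (Nat.le_ceil ρ)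
    linarith
  refine ⟨2 * C, ?_, hC'⟩
  have := hC' 0
  simp at this
  linarith

/-- When `M * t ≤ 1` the geometric base is at least 2 and beats the polynomial `(b + 1) ^ ρ`, so `ρ`
affects only the constant and not the rate. -/
theorem exists_listMoment_le_of_listMass_le (W : DMC X Y) (ρ : ℝ) :
    ∃ C : ℝ, 0 ≤ C ∧ ∀ {n : ℕ} {R t : ℝ} (_ : 0 ≤ R) {Q : (Fin n → X) → ℝ}
      (_ : Q ∈ stdSimplex ℝ (Fin n → X)) (_ : ∀ y, W.listMass Q y ≤ t)
      (_ : ⌊Real.exp (n * R)⌋₊ * t ≤ 1), ∃ f : Encoder X n R,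
        W.listMoment ρ f ≤ 1 + C * (⌊Real.exp (n * R)⌋₊ * t) := by
  obtain ⟨C, hC0, hC⟩ := exists_rpow_le_mul_two_pow ρ
  refine ⟨Real.exp 1 * (2 * C), by positivity, fun {n R t} hR {Q} hQ ht h1 => ?_⟩
  have hM : (0 : ℝ) < ⌊Real.exp (n * R)⌋₊ := by exact_mod_cast floor_exp_pos hR
  obtain ⟨f, hf⟩ := W.exists_listMoment_le ρ hR hQ
    (fun y => 2 * C * ((⌊Real.exp (n * R)⌋₊ : ℝ) * W.listMass Q y))
    (fun y => mul_nonneg (by positivity) (mul_nonneg hM.le (W.listMass_nonneg hQ y)))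
    (fun y hy b _ => by
      have hle := mul_le_mul_of_nonneg_left (ht y) hM.le
      set μ := (⌊Real.exp (n * R)⌋₊ : ℝ) * W.listMass Q y
      have hμ : 0 < μ := mul_pos hM hy
      rcases Nat.eq_zero_or_pos b with rfl | hb0
      · simp only [Nat.cast_zero, zero_add, Real.one_rpow, sub_self]
        positivity
      -- One factor of the base is set aside to pay for `μ` in `K`, because `μ * (1 + μ⁻¹) ≥ 1`; the
      -- other `c` factors dominate `2 ^ c`.
      obtain ⟨c, rfl⟩ : ∃ c, b = c + 1 := ⟨b - 1, by omega⟩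
      have hinv : (1 : ℝ) ≤ μ⁻¹ := (one_le_inv₀ hμ).2 (hle.trans h1)
      calc (((c + 1 : ℕ) : ℝ) + 1) ^ ρ - 1 ≤ C * 2 ^ (c + 1) := by linarith [hC (c + 1)]
        _ ≤ C * (μ * (1 + μ⁻¹) * (1 + μ⁻¹) ^ c * 2) := by
            rw [pow_succ]
            gcongr
            have h2 : (2 : ℝ) ^ c ≤ (1 + μ⁻¹) ^ c := by gcongr; linarith
            have h3 : 1 ≤ μ * (1 + μ⁻¹) := by
              rw [mul_add, mul_inv_cancel₀ hμ.ne']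
              linarith
            calc (2 : ℝ) ^ c ≤ 1 * (1 + μ⁻¹) ^ c := by rwa [one_mul]
              _ ≤ _ := by gcongr
        _ = 2 * C * μ * (1 + μ⁻¹) ^ (c + 1) := by rw [pow_succ]; ring)
  refine ⟨f, hf.trans ?_⟩
  have : ∑ y, W.outMass Q y * (2 * C * ((⌊Real.exp (n * R)⌋₊ : ℝ) * W.listMass Q y)) ≤
      2 * C * (⌊Real.exp (n * R)⌋₊ * t) := by
    calc _ ≤ ∑ y, W.outMass Q y * (2 * C * ((⌊Real.exp (n * R)⌋₊ : ℝ) * t)) := by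
          gcongr with y _
          · exact W.outMass_nonneg hQ y
          · exact ht y
      _ = _ := by rw [← Finset.sum_mul, W.sum_outMass hQ, one_mul]
  rw [mul_assoc (Real.exp 1)]
  gcongr

/-- Repeating `Q` over `n / N` blocks raises `E * W.massMoment s Q < 1` to that power; one extra
factor `E` covers the leftover `n % N` letters. -/
theorem mem_listRates_of_massMoment [Nonempty X] (W : DMC X Y) {ρ r s : ℝ} (hρ : 0 ≤ ρ)
    (hr : 0 ≤ r) (hs : 0 ≤ s) {R : ℝ} (hR : 0 ≤ R)
    (hb : ∀ (n : ℕ) (Q : (Fin n → X) → ℝ), Q ∈ stdSimplex ℝ (Fin n → X) →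
      ∃ f : Encoder X n R, W.listMoment ρ f ≤
        1 + Real.exp 1 * (((⌊Real.exp (n * R)⌋₊ : ℝ)) ^ r * W.massMoment s Q))
    {N : ℕ} (hN : 0 < N) {Q : (Fin N → X) → ℝ} (hQ : Q ∈ stdSimplex ℝ (Fin N → X))
    (h : Real.exp (N * R * r) * W.massMoment s Q < 1) : R ∈ W.listRates ρ := by
  set E := Real.exp (N * R * r)
  have hσ := W.massMoment_nonneg s hQ
  refine W.mem_listRates hρ hR
    (u := fun n => Real.exp 1 * E * (E * W.massMoment s Q) ^ (n / N)) ?_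
    (Eventually.of_forall fun n => ?_)
  · have h1 := (tendsto_pow_atTop_nhds_zero_of_lt_one (by positivity) h).comp
      (Nat.tendsto_div_const_atTop hN.ne')
    simpa using h1.const_mul (Real.exp 1 * E)
  · obtain ⟨Q', hQ', hle⟩ := W.exists_massMoment_le hs hQ (n / N) (n % N) n
      (Nat.mod_add_div n N).symm
    obtain ⟨f, hf⟩ := hb n Q' hQ'
    refine ⟨f, hf.trans ?_⟩
    have hMr : (⌊Real.exp (n * R)⌋₊ : ℝ) ^ r ≤ E * E ^ (n / N) := by
      calc (⌊Real.exp (n * R)⌋₊ : ℝ) ^ r ≤ Real.exp (n * R) ^ r :=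
            Real.rpow_le_rpow (by positivity) (floor_exp_le n R) hr
        _ = Real.exp (n * R * r) := (Real.exp_mul _ _).symm
        _ ≤ Real.exp (N * R * r + (n / N : ℕ) * (N * R * r)) := by
            refine Real.exp_le_exp.2 ?_
            have hn : (n : ℝ) ≤ N + (n / N : ℕ) * N := by
              have h1 := Nat.mod_add_div n N
              have h2 := Nat.mod_lt n hN
              have : n ≤ N + n / N * N := by
                rw [Nat.mul_comm] at h1
                omega
              exact_mod_cast this
            have := mul_le_mul_of_nonneg_right hn (mul_nonneg hR hr)
            linarith
        _ = E * E ^ (n / N) := by rw [Real.exp_add, Real.exp_nat_mul]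
    rw [mul_pow, mul_assoc (Real.exp 1)]
    refine add_le_add_right (mul_le_mul_of_nonneg_left ?_ (Real.exp_pos 1).le) 1
    calc _ ≤ (E * E ^ (n / N)) * W.massMoment s Q ^ (n / N) := by
          gcongr
          exact W.massMoment_nonneg s hQ'
      _ = _ := by ring

/-- Rates below `-log π₀` are achievable for every moment. -/
theorem mem_listRates_of_lt_neg_log [Nonempty X] (W : DMC X Y) {ρ : ℝ} (hρ : 0 ≤ ρ) {R : ℝ}
    (hR : 0 ≤ R) (h : R < -Real.log W.piZero) : R ∈ W.listRates ρ := by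
  obtain ⟨C, hC0, hC⟩ := W.exists_listMoment_le_of_listMass_le ρ
  have hlt : Real.exp R * W.piZero < 1 := by
    rw [← Real.exp_log W.piZero_pos, ← Real.exp_add]
    exact Real.exp_zero ▸ Real.exp_lt_exp.2 (by linarith)
  have hpos := mul_pos (Real.exp_pos R) W.piZero_pos
  have hle : ∀ n : ℕ, (⌊Real.exp (n * R)⌋₊ : ℝ) * W.piZero ^ n ≤ (Real.exp R * W.piZero) ^ n := by
    intro n
    rw [mul_pow, ← Real.exp_nat_mul]
    exact mul_le_mul_of_nonneg_right (floor_exp_le n R) (pow_nonneg W.piZero_pos.le n)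
  refine W.mem_listRates hρ hR (u := fun n => C * (Real.exp R * W.piZero) ^ n) ?_
    (Eventually.of_forall fun n => ?_)
  · simpa using (tendsto_pow_atTop_nhds_zero_of_lt_one hpos.le hlt).const_mul C
  · obtain ⟨Q, hQ, hQle⟩ := W.exists_listMass_le_piZero_pow n
    obtain ⟨f, hf⟩ := hC hR hQ hQle ((hle n).trans (pow_le_one₀ hpos.le hlt.le))
    refine ⟨f, hf.trans ?_⟩
    gcongr
    exact hle n

theorem le_listCapacity_of_forall_mem [Nonempty X] (W : DMC X Y) {ρ : ℝ} (hρ : 0 ≤ ρ)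
    {a : EReal} (h : ∀ R : ℝ, 0 ≤ R → (R : EReal) < a → R ∈ W.listRates ρ) :
    a ≤ W.listCapacity ρ := by
  by_contra! hlt
  obtain ⟨R, h1, h2⟩ := EReal.lt_iff_exists_real_btwn.1 hlt
  have hR : 0 ≤ R := by exact_mod_cast ((W.listCapacity_nonneg hρ).trans_lt h1).le
  exact h1.not_ge (le_biSup (fun R : ℝ => (R : EReal)) (h R hR h2))

theorem neg_log_piZero_le_listCapacity [Nonempty X] (W : DMC X Y) {ρ : ℝ} (hρ : 0 ≤ ρ) :
    ((-Real.log W.piZero : ℝ) : EReal) ≤ W.listCapacity ρ :=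
  W.le_listCapacity_of_forall_mem hρ fun _ hR h =>
    W.mem_listRates_of_lt_neg_log hρ hR (EReal.coe_lt_coe_iff.1 h)

/-! ### Converse for large `ρ`. -/

theorem exists_pos_le_prob (W : DMC X Y) :
    ∃ w : ℝ, 0 < w ∧ ∀ x y, 0 < W.prob x y → w ≤ W.prob x y := by
  classical
  -- The inserted 1 only guarantees that the minimum is over a nonempty set.
  let S : Finset ℝ := insert 1 ((Finset.univ.image fun p : X × Y => W.prob p.1 p.2).filter (0 < ·))
  have hS : S.Nonempty := ⟨1, by simp [S]⟩
  refine ⟨S.min' hS, ?_, fun x y h => S.min'_le _ ?_⟩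
  · have := S.min'_mem hS
    simp only [S, Finset.mem_insert, Finset.mem_filter] at this
    rcases this with h | h
    · rw [h]; exact one_pos
    · exact h.2
  · simp only [S, Finset.mem_insert, Finset.mem_filter, Finset.mem_image, Finset.mem_univ,
      true_and]
    exact Or.inr ⟨⟨(x, y), rfl⟩, h⟩

/-- Some output has a long list, which keeps the moments of the list length away from zero. -/
theorem le_listMoment [Nonempty X] (W : DMC X Y) {ρ : ℝ} (hρ : 0 ≤ ρ) {w : ℝ} (hw : 0 < w)
    (hwle : ∀ x y, 0 < W.prob x y → w ≤ W.prob x y) {n : ℕ} {R : ℝ} (hR : 0 ≤ R)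
    (f : Encoder X n R) :
    (W.piZero * w) ^ n * (W.piZero ^ n * ⌊Real.exp (n * R)⌋₊) ^ ρ ≤ W.listMoment ρ f := by
  have hM : (0 : ℝ) < ⌊Real.exp (n * R)⌋₊ := by exact_mod_cast floor_exp_pos hR
  have hπ := pow_pos W.piZero_pos n
  obtain ⟨y, hy⟩ := W.exists_output_card_ge n Finset.univ f
  rw [Finset.card_univ, Fintype.card_fin] at hy
  change _ ≤ ((W.messageList f y).card : ℝ) at hy
  have hpt : ∀ m ∈ W.messageList f y, w ^ n ≤ W.blockProb (f m) y := by
    intro m hm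
    have hm' : 0 < W.blockProb (f m) y := by simpa [messageList] using hm
    rw [blockProb_pos_iff] at hm'
    simpa [blockProb] using Finset.prod_le_prod (s := (Finset.univ : Finset (Fin n))) (fun _ _ => hw.le)
      fun i _ => hwle _ _ (hm' i)
  set M := (⌊Real.exp (n * R)⌋₊ : ℝ)
  set l := ((W.messageList f y).card : ℝ)
  have hl : 0 ≤ l := Nat.cast_nonneg _
  calc (W.piZero * w) ^ n * (W.piZero ^ n * M) ^ ρ
      = M⁻¹ * ((W.piZero ^ n * M) * (w ^ n * (W.piZero ^ n * M) ^ ρ)) := by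
        rw [mul_pow]; field_simp
    _ ≤ M⁻¹ * (l * (w ^ n * l ^ ρ)) := by gcongr
    _ = M⁻¹ * ∑ m ∈ W.messageList f y, w ^ n * l ^ ρ := by
        rw [Finset.sum_const, nsmul_eq_mul]
    _ ≤ M⁻¹ * ∑ m ∈ W.messageList f y, W.blockProb (f m) y * l ^ ρ := by
        gcongr with m hm
        exact hpt m hm
    _ ≤ W.listMoment ρ f := by
        rw [listMoment]
        refine mul_le_mul_of_nonneg_left ?_ (by positivity)
        have hnn : ∀ m (y : Fin n → Y),
            0 ≤ W.blockProb (f m) y * ((W.messageList f y).card : ℝ) ^ ρ := fun m y =>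
          mul_nonneg (W.blockProb_nonneg _ _) (by positivity)
        refine (Finset.sum_le_sum fun m _ => Finset.single_le_sum
          (fun y _ => hnn m y) (Finset.mem_univ y)).trans ?_
        exact Finset.sum_le_sum_of_subset_of_nonneg (Finset.subset_univ _)
          fun m _ _ => Finset.sum_nonneg fun y _ => hnn m y

/-- A rate above `-log π₀ + K/ρ` makes the exponent `δ` in the bound of `le_listMoment` positive, so
the moments diverge. The factor `(1/2) ^ ρ` in the proof pays for the floor in `M`. -/
theorem exists_listCapacity_le [Nonempty X] (W : DMC X Y) :
    ∃ K : ℝ, ∀ ρ : ℝ, 0 < ρ → W.listCapacity ρ ≤ ((-Real.log W.piZero + K / ρ : ℝ) : EReal) := by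
  obtain ⟨w, hw, hwle⟩ := W.exists_pos_le_prob
  have hπ := W.piZero_pos
  refine ⟨-Real.log (W.piZero * w), fun ρ hρ => iSup₂_le fun R hR => ?_⟩
  obtain ⟨hR0, f, hf⟩ := hR
  rw [EReal.coe_le_coe_iff]
  by_contra! hlt
  set δ := Real.log (W.piZero * w) + ρ * (R + Real.log W.piZero) with hδ
  have hδpos : 0 < δ := by
    have : -Real.log (W.piZero * w) / ρ < R + Real.log W.piZero := by linarith
    rw [div_lt_iff₀ hρ] at this
    linarith
  have hlow : ∀ n : ℕ, Real.exp δ ^ (n + 1) * (1 / 2 : ℝ) ^ ρ ≤ W.listMoment ρ (f n) := by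
    intro n
    refine le_trans ?_ (W.le_listMoment hρ.le hw hwle hR0 (f n))
    have hM := exp_le_two_mul_floor_exp (n := n + 1) hR0
    have h1 : Real.exp (R + Real.log W.piZero) ^ (n + 1) * (1 / 2) ≤
        W.piZero ^ (n + 1) * ⌊Real.exp ((n + 1 : ℕ) * R)⌋₊ := by
      rw [Real.exp_add, Real.exp_log hπ, mul_pow, ← Real.exp_nat_mul]
      have := mul_le_mul_of_nonneg_left hM (pow_nonneg hπ.le (n + 1))
      linarith
    have h2 := Real.rpow_le_rpow (by positivity) h1 hρ.le
    refine le_trans (le_of_eq ?_) (mul_le_mul_of_nonneg_left h2 (by positivity))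
    rw [Real.mul_rpow (by positivity) (by positivity), ← Real.exp_nat_mul, ← Real.exp_nat_mul,
      ← Real.exp_mul, ← mul_assoc]
    congr 1
    rw [← Real.exp_log (mul_pos hπ hw), ← Real.exp_nat_mul, ← Real.exp_add]
    congr 1
    rw [hδ]
    ring
  have htop : Tendsto (fun n : ℕ => Real.exp δ ^ (n + 1) * (1 / 2 : ℝ) ^ ρ) atTop atTop :=
    ((tendsto_pow_atTop_atTop_of_one_lt (Real.one_lt_exp_iff.2 hδpos)).comp
      (tendsto_add_atTop_nat 1)).atTop_mul_const (by positivity)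
  exact not_tendsto_nhds_of_tendsto_atTop (tendsto_atTop_mono hlow htop) 1 hf

theorem tendsto_listCapacity_atTop [Nonempty X] (W : DMC X Y) :
    Tendsto (fun ρ : ℝ => W.listCapacity ρ) atTop (𝓝 ((-Real.log W.piZero : ℝ) : EReal)) := by
  obtain ⟨K, hK⟩ := W.exists_listCapacity_le
  have hlim : Tendsto (fun ρ : ℝ => ((-Real.log W.piZero + K / ρ : ℝ) : EReal)) atTop
      (𝓝 ((-Real.log W.piZero : ℝ) : EReal)) := by
    refine (continuous_coe_real_ereal.tendsto _).comp ?_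
    simpa using (tendsto_const_nhds.div_atTop tendsto_id).const_add (-Real.log W.piZero)
  refine tendsto_of_tendsto_of_tendsto_of_le_of_le' tendsto_const_nhds hlim ?_ ?_
  · filter_upwards [eventually_gt_atTop 0] with ρ hρ
    exact W.neg_log_piZero_le_listCapacity hρ.le
  · filter_upwards [eventually_gt_atTop 0] with ρ hρ using hK ρ hρ

/-! ### Criterion for positive capacity. -/

/-- Under uniform inputs the letter `y` has positive probability and excludes `x'`, so the expected
list mass is below 1; by continuity this leaves room for a small positive rate. -/
theorem listCapacity_pos [Nonempty X] (W : DMC X Y) {ρ : ℝ} (hρ : 0 < ρ)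
    (h : ∃ x x' y, W.prob x' y < W.prob x y ∧ W.prob x' y = 0) : 0 < W.listCapacity ρ := by
  classical
  obtain ⟨x, x', y, hlt, h0⟩ := h
  rw [h0] at hlt
  let Q : (Fin 1 → X) → ℝ := fun _ => (Fintype.card (Fin 1 → X) : ℝ)⁻¹
  have hc : (0 : ℝ) < (Fintype.card (Fin 1 → X) : ℝ) := by exact_mod_cast Fintype.card_pos
  have hQ : Q ∈ stdSimplex ℝ (Fin 1 → X) := by
    refine ⟨fun _ => by positivity, ?_⟩
    simp only [Q, Finset.sum_const, Finset.card_univ, nsmul_eq_mul]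
    exact mul_inv_cancel₀ hc.ne'
  have hσ : W.massMoment 1 Q < 1 := by
    refine lt_of_lt_of_eq ?_ (W.sum_outMass hQ)
    refine Finset.sum_lt_sum (fun y _ => mul_le_of_le_one_right (W.outMass_nonneg hQ y)
      (Real.rpow_le_one (W.listMass_nonneg hQ y) (W.listMass_le_one hQ y) zero_le_one))
      ⟨fun _ => y, Finset.mem_univ _, mul_lt_of_lt_one_right ?_ ?_⟩
    · refine Finset.sum_pos' (fun x _ => mul_nonneg (hQ.1 x) (W.blockProb_nonneg _ _))
        ⟨fun _ => x, Finset.mem_univ _, mul_pos (inv_pos.2 hc) ?_⟩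
      exact W.blockProb_pos_iff.2 fun _ => hlt
    · rw [Real.rpow_one, ← hQ.2]
      refine Finset.sum_lt_sum_of_subset (i := fun _ => x') (Finset.filter_subset _ _)
        (Finset.mem_univ _) ?_ (inv_pos.2 hc) fun z _ _ => hQ.1 z
      simp [blockProb, h0]
  have hcont : Tendsto (fun R : ℝ => Real.exp ((1 : ℕ) * R * (ρ + 1)) * W.massMoment 1 Q)
      (𝓝[>] 0) (𝓝 (W.massMoment 1 Q)) := by
    have : Continuous fun R : ℝ => Real.exp ((1 : ℕ) * R * (ρ + 1)) * W.massMoment 1 Q := by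
      fun_prop
    simpa using (this.tendsto 0).mono_left nhdsWithin_le_nhds
  obtain ⟨R, hR, hR0⟩ :=
    ((hcont.eventually (gt_mem_nhds hσ)).and self_mem_nhdsWithin).exists
  have hR0' : 0 < R := hR0
  have hmem : R ∈ W.listRates ρ :=
    W.mem_listRates_of_massMoment hρ.le (by linarith) zero_le_one hR0'.le
      (fun n Q' hQ' => W.exists_listMoment_le_massMoment_one hρ hR0'.le hQ') one_pos hQ hR
  exact (EReal.coe_pos.2 hR0').trans_le (le_biSup (fun R : ℝ => (R : EReal)) hmem)

/-- If all inputs have the same support, every possible output lists all messages, so erasure is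
certain once there are two of them. -/
theorem exists_of_zueCapacity_pos (W : DMC X Y) (h : 0 < W.zueCapacity) :
    ∃ x x' y, W.prob x' y < W.prob x y ∧ W.prob x' y = 0 := by
  by_contra! hne
  refine h.not_ge (iSup₂_le fun R hR => ?_)
  obtain ⟨hR0, f, hf⟩ := hR
  rw [EReal.coe_nonpos]
  by_contra! hRpos
  have hsupp : ∀ x x' y, 0 < W.prob x y → 0 < W.prob x' y := by
    intro x x' y hx
    refine (W.prob_nonneg x' y).lt_of_ne fun h0 => ?_
    exact hne x x' y (by rwa [← h0]) h0.symm
  have htop : Tendsto (fun n : ℕ => Real.exp ((n + 1 : ℕ) * R)) atTop atTop :=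
    Real.tendsto_exp_atTop.comp ((tendsto_natCast_atTop_atTop.comp
      (tendsto_add_atTop_nat 1)).atTop_mul_const hRpos)
  have hone : ∀ᶠ n in atTop, W.erasureProb (f n) = 1 := by
    filter_upwards [htop.eventually_ge_atTop 2] with n hn
    have hM : 2 ≤ ⌊Real.exp ((n + 1 : ℕ) * R)⌋₊ := Nat.le_floor (by exact_mod_cast hn)
    have hM0 : (⌊Real.exp ((n + 1 : ℕ) * R)⌋₊ : ℝ) ≠ 0 := by
      exact_mod_cast (floor_exp_pos hR0).ne'
    rw [erasureProb_eq]
    have : ∀ m y, W.blockProb (f n m) y * (if 2 ≤ (W.messageList (f n) y).card then 1 else 0) =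
        W.blockProb (f n m) y := by
      intro m y
      rcases (W.blockProb_nonneg (f n m) y).eq_or_lt with h0 | h0
      · simp [← h0]
      have hall : W.messageList (f n) y = Finset.univ := by
        refine Finset.filter_true_of_mem fun m' _ => ?_
        rw [blockProb_pos_iff] at h0 ⊢
        exact fun i => hsupp _ _ _ (h0 i)
      rw [hall, Finset.card_univ, Fintype.card_fin, if_pos hM, mul_one]
    simp_rw [this, sum_blockProb]
    simp only [Finset.sum_const, Finset.card_univ, Fintype.card_fin, nsmul_eq_mul, mul_one]
    exact inv_mul_cancel₀ hM0
  have := tendsto_nhds_unique (tendsto_const_nhds.congr' (hone.mono fun _ h => h.symm)) hf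
  exact one_ne_zero this

/-! ### The limit `ρ → 0`. -/

/-- The relative frequencies of the codewords of an encoder. -/
noncomputable def codewordMass {n : ℕ} {R : ℝ} (f : Encoder X n R) (x : Fin n → X) : ℝ := by
  classical
  exact (⌊Real.exp (n * R)⌋₊ : ℝ)⁻¹ * ∑ m, if f m = x then 1 else 0

theorem sum_codewordMass_mul {n : ℕ} {R : ℝ} (f : Encoder X n R) (g : (Fin n → X) → ℝ) :
    ∑ x, codewordMass f x * g x = (⌊Real.exp (n * R)⌋₊ : ℝ)⁻¹ * ∑ m, g (f m) := by
  classical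
  simp only [codewordMass, mul_assoc, ← Finset.mul_sum, Finset.sum_mul]
  rw [Finset.sum_comm]
  simp

theorem codewordMass_mem {n : ℕ} {R : ℝ} (hR : 0 ≤ R) (f : Encoder X n R) :
    codewordMass f ∈ stdSimplex ℝ (Fin n → X) := by
  classical
  have hM : (⌊Real.exp (n * R)⌋₊ : ℝ) ≠ 0 := by exact_mod_cast (floor_exp_pos hR).ne'
  refine ⟨fun x => mul_nonneg (by positivity) (Finset.sum_nonneg fun m _ => ?_), ?_⟩
  · split_ifs <;> simp
  · simpa [hM] using sum_codewordMass_mul f fun _ => 1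

/-- Under the codeword frequencies, counted with multiplicity, the mass compatible with `y` is the
list length divided by `M`. -/
theorem massMoment_codewordMass (W : DMC X Y) (ρ : ℝ) {n : ℕ} {R : ℝ} (f : Encoder X n R) :
    W.massMoment ρ (codewordMass f) =
      ((⌊Real.exp (n * R)⌋₊ : ℝ)⁻¹) ^ ρ * W.listMoment ρ f := by
  have hl : ∀ y, W.listMass (codewordMass f) y =
      (⌊Real.exp (n * R)⌋₊ : ℝ)⁻¹ * (W.messageList f y).card := by
    intro y
    have := sum_codewordMass_mul f fun x => if 0 < W.blockProb x y then 1 else 0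
    simpa [listMass, messageList, Finset.sum_filter] using this
  simp only [massMoment, outMass, listMoment]
  simp_rw [sum_codewordMass_mul f, hl, Real.mul_rpow (inv_nonneg.2 (Nat.cast_nonneg _))
    (Nat.cast_nonneg _)]
  rw [Finset.sum_comm (s := Finset.univ (α := Fin _))]
  simp only [Finset.mul_sum, Finset.sum_mul]
  refine Finset.sum_congr rfl fun y _ => Finset.sum_congr rfl fun m _ => ?_
  ring

/-- At `ρ = 0` the expression equals 1 with derivative `b - (1 - ε) * a < 0`. The proof makes this
explicit through `e^(-aρ) ≤ 1/(1 + aρ)` and `1 - bρ ≤ e^(-bρ)`. -/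
theorem exists_exp_mul_lt_one {a b ε : ℝ} (ha : 0 < a) (hε1 : ε ≤ 1)
    (h : b < (1 - ε) * a) :
    ∃ ρ : ℝ, 0 < ρ ∧ ρ ≤ 1 ∧
      Real.exp (b * ρ) * (Real.exp (-(a * ρ)) * (1 - ε) + ε) < 1 := by
  have hcont : Tendsto (fun ρ : ℝ => (1 + a * ρ) * b) (𝓝[>] 0) (𝓝 b) := by
    have : Continuous fun ρ : ℝ => (1 + a * ρ) * b := by fun_prop
    simpa using (this.tendsto 0).mono_left nhdsWithin_le_nhds
  obtain ⟨ρ, h1, h2, h3⟩ := ((hcont.eventually (gt_mem_nhds h)).and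
    (Ioc_mem_nhdsGT (zero_lt_one' ℝ))).exists
  refine ⟨ρ, h2, h3, ?_⟩
  have hx : 0 < 1 + a * ρ := by positivity
  have e1 : Real.exp (-(a * ρ)) ≤ (1 + a * ρ)⁻¹ := by
    rw [Real.exp_neg]
    exact inv_anti₀ hx (by linarith [Real.add_one_le_exp (a * ρ)])
  have e2 : 1 - b * ρ ≤ Real.exp (-(b * ρ)) := by linarith [Real.add_one_le_exp (-(b * ρ))]
  have e3 : (1 + a * ρ)⁻¹ * (1 - ε) + ε < 1 - b * ρ := by
    have : (1 + a * ρ)⁻¹ * (1 - ε) < 1 - b * ρ - ε := by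
      rw [inv_mul_lt_iff₀ hx]
      nlinarith [mul_lt_mul_of_pos_right h1 h2]
    linarith
  have e4 : Real.exp (-(a * ρ)) * (1 - ε) + ε < Real.exp (-(b * ρ)) := by
    have := mul_le_mul_of_nonneg_right e1 (sub_nonneg.2 hε1)
    linarith
  calc _ < Real.exp (b * ρ) * Real.exp (-(b * ρ)) := by gcongr
    _ = 1 := by rw [← Real.exp_add]; simp

/-- Slightly reducing a rate of zero undetected error makes some moment of the list length tend
to one. -/
theorem exists_mem_listRates [Nonempty X] (W : DMC X Y) {R R' : ℝ} (hR : R ∈ W.zueRates)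
    (hR' : 0 ≤ R') (hlt : R' < R) : ∃ ρ : ℝ, 0 < ρ ∧ R' ∈ W.listRates ρ := by
  obtain ⟨hR0, f, hf⟩ := hR
  -- A single blocklength `n + 1` is enough; the term `log 2 / (n + 1)` accounts for rounding
  -- `e^(nR)` down to an integer.
  have hlim : Tendsto (fun n : ℕ => (1 - W.erasureProb (f n)) * (R - Real.log 2 / (n + 1 : ℕ)))
      atTop (𝓝 R) := by
    have h1 : Tendsto (fun n : ℕ => Real.log 2 / ((n + 1 : ℕ) : ℝ)) atTop (𝓝 0) :=
      tendsto_const_nhds.div_atTop (tendsto_natCast_atTop_atTop.comp (tendsto_add_atTop_nat 1))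
    simpa using (hf.const_sub 1).mul (h1.const_sub R)
  obtain ⟨n, hn, hε1⟩ := ((hlim.eventually (lt_mem_nhds hlt)).and
    (hf.eventually (gt_mem_nhds one_pos))).exists
  have hN : (0 : ℝ) < (n + 1 : ℕ) := by positivity
  have hM : (0 : ℝ) < ⌊Real.exp ((n + 1 : ℕ) * R)⌋₊ := by exact_mod_cast floor_exp_pos hR0
  have hlog : (n + 1 : ℕ) * R - Real.log 2 ≤ Real.log ⌊Real.exp ((n + 1 : ℕ) * R)⌋₊ := by
    have := Real.log_le_log (Real.exp_pos _) (exp_le_two_mul_floor_exp (n := n + 1) hR0)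
    rw [Real.log_exp, Real.log_mul two_ne_zero hM.ne'] at this
    linarith
  have hε := W.erasureProb_nonneg (f n)
  set ε := W.erasureProb (f n)
  have hb : (n + 1 : ℕ) * R' < (1 - ε) * Real.log ⌊Real.exp ((n + 1 : ℕ) * R)⌋₊ := by
    have h1 := mul_lt_mul_of_pos_left hn hN
    have h2 := mul_le_mul_of_nonneg_left hlog (sub_nonneg.2 hε1.le)
    refine h1.trans_le (le_trans (le_of_eq ?_) h2)
    field_simp
  have ha : 0 < Real.log ⌊Real.exp ((n + 1 : ℕ) * R)⌋₊ :=
    pos_of_mul_pos_right (lt_of_le_of_lt (by positivity) hb) (sub_nonneg.2 hε1.le)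
  obtain ⟨ρ, hρ, hρ1, hlt1⟩ := exists_exp_mul_lt_one ha hε1.le hb
  refine ⟨ρ, hρ, W.mem_listRates_of_massMoment hρ.le hρ.le hρ.le hR'
    (fun n Q hQ => W.exists_listMoment_le_of_le_one hρ hρ1 hR' hQ) n.succ_pos
    (codewordMass_mem hR0 (f n)) (lt_of_le_of_lt ?_ hlt1)⟩
  gcongr
  rw [massMoment_codewordMass]
  refine (mul_le_mul_of_nonneg_left (W.listMoment_le_of_erasureProb hρ.le hR0 (f n))
    (by positivity)).trans (le_of_eq ?_)
  have hexp : ((⌊Real.exp ((n + 1 : ℕ) * R)⌋₊ : ℝ)⁻¹) ^ ρ =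
      Real.exp (-(Real.log ⌊Real.exp ((n + 1 : ℕ) * R)⌋₊ * ρ)) := by
    rw [Real.inv_rpow hM.le, Real.exp_neg, Real.rpow_def_of_pos hM]
  rw [← hexp, Real.inv_rpow hM.le]
  have := (Real.rpow_pos_of_pos hM ρ).ne'
  field_simp
  ring

theorem tendsto_listCapacity_zero [Nonempty X] (W : DMC X Y) :
    Tendsto (fun ρ : ℝ => W.listCapacity ρ) (𝓝[>] 0) (𝓝 W.zueCapacity) := by
  refine tendsto_order.2 ⟨fun a ha => ?_, fun a ha => ?_⟩
  -- Capacity decreases in `ρ`, so one good `ρ` settles all smaller ones.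
  · suffices ∃ ρ : ℝ, 0 < ρ ∧ a < W.listCapacity ρ by
      obtain ⟨ρ, hρ, h⟩ := this
      filter_upwards [Ioc_mem_nhdsGT hρ] with ρ' hρ'
      exact h.trans_le (W.listCapacity_anti hρ'.1.le hρ'.2)
    rcases lt_or_ge a 0 with h0 | h0
    · exact ⟨1, one_pos, h0.trans_le (W.listCapacity_nonneg zero_le_one)⟩
    obtain ⟨R, hR, haR⟩ := lt_biSup_iff.1 ha
    obtain ⟨R', h1, h2⟩ := EReal.lt_iff_exists_real_btwn.1 haR
    have hR' : 0 ≤ R' := by exact_mod_cast (h0.trans_lt h1).le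
    obtain ⟨ρ, hρ, hmem⟩ := W.exists_mem_listRates hR hR' (EReal.coe_lt_coe_iff.1 h2)
    exact ⟨ρ, hρ, h1.trans_le (le_biSup (fun R : ℝ => (R : EReal)) hmem)⟩
  · filter_upwards [self_mem_nhdsWithin] with ρ hρ
    exact (W.listCapacity_le_zueCapacity hρ).trans_lt ha

end DMC

theorem proposition6 {X Y : Type*} [Fintype X] [Fintype Y] [Nonempty X] (W : DMC X Y) :
    (∀ ρ : ℝ, 0 < ρ → W.listCapacity ρ ≤ W.zueCapacity) ∧
    (∀ ρ : ℝ, 0 < ρ →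
      (0 < W.listCapacity ρ ↔ 0 < W.zueCapacity) ∧
      (0 < W.zueCapacity ↔ ∃ x x' y, W.prob x' y < W.prob x y ∧ W.prob x' y = 0)) ∧
    Tendsto (fun ρ : ℝ => W.listCapacity ρ) (𝓝[>] 0) (𝓝 W.zueCapacity) ∧
    Tendsto (fun ρ : ℝ => W.listCapacity ρ) atTop (𝓝 ((-Real.log W.piZero : ℝ) : EReal)) := by
  have hle : ∀ ρ : ℝ, 0 < ρ → W.listCapacity ρ ≤ W.zueCapacity :=
    fun ρ hρ => W.listCapacity_le_zueCapacity hρ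
  refine ⟨hle, fun ρ hρ => ⟨⟨fun h => h.trans_le (hle ρ hρ), fun h => ?_⟩, ⟨?_, fun h => ?_⟩⟩,
    W.tendsto_listCapacity_zero, W.tendsto_listCapacity_atTop⟩
  · exact W.listCapacity_pos hρ (W.exists_of_zueCapacity_pos h)
  · exact W.exists_of_zueCapacity_pos
  · exact (W.listCapacity_pos hρ h).trans_le (hle ρ hρ)
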